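/- Call a $2$-dimensional convex polytope in $\mathbb{R}^2$ a polygon, and call it a lattice polygon if all of its vertices belong to $\mathbb{Z}^2$. Let $P$ be a polygon with vertex set $\mathcal{V}$. A point $x\in\mathbb{R}^2\setminus P$ can be inserted in $P$ if the vertex set of the convex hull of $P\cup\{x\}$ is exactly $\mathcal{V}\cup\{x\}$; the insertion move then replaces $P$ by this convex hull. A vertex $v\in\mathcal{V}$ can be deleted from $P$ if the convex hull of $\mathcal{V}\setminus\{v\}$ is $2$-dimensional; the deletion move then replaces $P$ by this convex hull. Let $\Lambda(2)$ be the graph whose vertices are the lattice polygons and whose edges connect any two lattice polygons that can be obtained from one another by an insertion move or a deletion move. Theorem. The subgraph induced in $\Lambda(2)$ by the lattice polygons with exactly five or exactly six vertices (the lattice pentagons and the lattice hexagons) is connected. -/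

import Mathlib

/-- The `d`-dimensional polytopes contained in `ℝ^d`: convex hulls of finite sets of points whose
affine hull is the whole space. -/
structure FullPolytope (d : ℕ) where
  /-- The underlying set of points. -/
  carrier : Set (EuclideanSpace ℝ (Fin d))
  isPolytope : ∃ S : Finset (EuclideanSpace ℝ (Fin d)),
    carrier = convexHull ℝ (S : Set (EuclideanSpace ℝ (Fin d)))
  fullDim : affineSpan ℝ carrier = ⊤

namespace FullPolytope

variable {d : ℕ}

/-- The vertex set of a polytope (its extreme points). -/
def vertices (P : FullPolytope d) : Set (EuclideanSpace ℝ (Fin d)) :=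
  P.carrier.extremePoints ℝ

/-- The point `x`, which lies outside of `P`, can be inserted in `P`: the convex hull of
`P ∪ {x}` has the vertices of `P` and the point `x` as its vertex set. -/
def CanInsert (P : FullPolytope d) (x : EuclideanSpace ℝ (Fin d)) : Prop :=
  x ∉ P.carrier ∧ (convexHull ℝ (P.carrier ∪ {x})).extremePoints ℝ = P.vertices ∪ {x}

/-- The vertex `v` can be deleted from `P`: the convex hull of the other vertices is still
`d`-dimensional. -/
def CanDelete (P : FullPolytope d) (v : EuclideanSpace ℝ (Fin d)) : Prop :=
  v ∈ P.vertices ∧ affineSpan ℝ (convexHull ℝ (P.vertices \ {v})) = ⊤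

/-- `Q` is obtained from `P` by an insertion move. -/
def InsertionMove (P Q : FullPolytope d) : Prop :=
  ∃ x, P.CanInsert x ∧ Q.carrier = convexHull ℝ (P.carrier ∪ {x})

/-- `Q` is obtained from `P` by a deletion move. -/
def DeletionMove (P Q : FullPolytope d) : Prop :=
  ∃ v, P.CanDelete v ∧ Q.carrier = convexHull ℝ (P.vertices \ {v})

/-- A lattice polytope: all the vertices belong to `ℤ^d`. -/
def IsLattice (P : FullPolytope d) : Prop :=
  ∀ v ∈ P.vertices, ∀ i, ∃ z : ℤ, v i = (z : ℝ)

end FullPolytope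

/-- The graph `Γ(d)` on all `d`-dimensional polytopes in `ℝ^d`: two distinct polytopes are adjacent
when one is obtained from the other by an insertion move or a deletion move. -/
def polytopeGraph (d : ℕ) : SimpleGraph (FullPolytope d) :=
  SimpleGraph.fromRel fun P Q => P.InsertionMove Q ∨ P.DeletionMove Q

/-- The graph `Λ(d)`: the subgraph induced in `Γ(d)` by the lattice polytopes. -/
def latticePolytopeGraph (d : ℕ) : SimpleGraph {P : FullPolytope d // P.IsLattice} :=
  (polytopeGraph d).induce {P : FullPolytope d | P.IsLattice}

/-! A polygon is encoded by its finite vertex set in `ℤ × ℤ`, convex position being witnessed by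
strict minimisers of linear functionals. Inside a fixed set in convex position, any two five-point
subsets are linked by exchanging one vertex at a time through hexagons (`linked_of_subset`), so it
suffices to find large sets in convex position containing given pentagons.

If a pentagon stays in convex position when the point at infinity in direction `u` is added
(`ConvexChain`), all far points of a parabola of axis `u` can be added to it
(`ConvexChain.exists_union_parabola`). Hence all chains with the same `u` are linked. Half a
parabola is a chain for two independent directions, which links chains with different directions
(`ConvexChain.linked_of_convexChain`).

It remains to turn any lattice pentagon into a chain (`Pentagon.nearChain`). It is one if the two
neighbours of some edge diverge beyond that edge. Otherwise one exchange produces such an edge,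
unless all five triangles on consecutive vertices have the same area. That would force the golden
ratio to be rational. -/

/-- Twice the signed area of the parallelogram spanned by two integer vectors. -/
def cross (u v : ℤ × ℤ) : ℤ := u.1 * v.2 - u.2 * v.1

/-- Twice the signed area of the triangle `abc`. -/
def orient (a b c : ℤ × ℤ) : ℤ := cross (b - a) (c - a)

/-- Every point of `S` is the strict minimiser over `S` of some linear functional. -/
def ConvexPosition (S : Set (ℤ × ℤ)) : Prop :=
  ∀ v ∈ S, ∃ p q : ℝ, ∀ w ∈ S, w ≠ v → p * v.1 + q * v.2 < p * w.1 + q * w.2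

/-- Every point of `S` is the strict minimiser over `S` of an integral linear functional that is
positive on `u`: the set `S` remains in convex position when the point at infinity in the
direction of `u` is added to it. -/
def ConvexChain (u : ℤ × ℤ) (S : Set (ℤ × ℤ)) : Prop :=
  ∀ v ∈ S, ∃ δ : ℤ × ℤ, 0 < cross δ u ∧ ∀ w ∈ S, w ≠ v → cross δ v < cross δ w

/-! ### Basic properties of convex position and convex chains -/

theorem ConvexPosition.mono {S T : Set (ℤ × ℤ)} (h : ConvexPosition T) (hST : S ⊆ T) :
    ConvexPosition S := by
  intro v hv
  obtain ⟨p, q, hpq⟩ := h v (hST hv)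
  exact ⟨p, q, fun w hw => hpq w (hST hw)⟩

theorem convexPosition_of_cross {S : Set (ℤ × ℤ)}
    (h : ∀ v ∈ S, ∃ δ : ℤ × ℤ, ∀ w ∈ S, w ≠ v → cross δ v < cross δ w) : ConvexPosition S := by
  intro v hv
  obtain ⟨δ, hδ⟩ := h v hv
  refine ⟨-δ.2, δ.1, fun w hw hne => ?_⟩
  have := hδ w hw hne
  simp only [cross] at this
  have h' : ((δ.1 * v.2 - δ.2 * v.1 : ℤ) : ℝ) < ((δ.1 * w.2 - δ.2 * w.1 : ℤ) : ℝ) := by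
    exact_mod_cast this
  push_cast at h'
  linarith

theorem ConvexChain.convexPosition {u : ℤ × ℤ} {S : Set (ℤ × ℤ)} (h : ConvexChain u S) :
    ConvexPosition S :=
  convexPosition_of_cross fun v hv => (h v hv).imp fun _ hδ => hδ.2

theorem ConvexChain.mono {u : ℤ × ℤ} {S T : Set (ℤ × ℤ)} (h : ConvexChain u T) (hST : S ⊆ T) :
    ConvexChain u S := by
  intro v hv
  obtain ⟨δ, h0, hδ⟩ := h v (hST hv)
  exact ⟨δ, h0, fun w hw => hδ w (hST hw)⟩

theorem ConvexChain.ne_zero {u : ℤ × ℤ} {S : Set (ℤ × ℤ)} (h : ConvexChain u S)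
    (hS : S.Nonempty) : u ≠ 0 := by
  rintro rfl
  obtain ⟨v, hv⟩ := hS
  obtain ⟨δ, h0, -⟩ := h v hv
  simp [cross] at h0

/-! ### Parabolas -/

/-- The points of a parabola of axis directed by `u`. -/
def parabola (w u : ℤ × ℤ) (k : ℤ) : ℤ × ℤ := k • w + (k ^ 2) • u

theorem cross_parabola (δ w u : ℤ × ℤ) (k : ℤ) :
    cross δ (parabola w u k) = k * cross δ w + k ^ 2 * cross δ u := by
  simp [cross, parabola]; ring

/-- The normal vector of the tangent to the parabola at the point of parameter `k`. -/
def parabolaTangent (w u : ℤ × ℤ) (k : ℤ) : ℤ × ℤ := cross w u • (w + (2 * k) • u)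

theorem cross_parabolaTangent_left (w u : ℤ × ℤ) (k : ℤ) :
    cross (parabolaTangent w u k) w = -(2 * k) * cross w u ^ 2 := by
  simp [cross, parabolaTangent]; ring

theorem cross_parabolaTangent_right (w u : ℤ × ℤ) (k : ℤ) :
    cross (parabolaTangent w u k) u = cross w u ^ 2 := by
  simp [cross, parabolaTangent]; ring

/-- The two values differ by `cross w u ^ 2 * (j - k) ^ 2`: a tangent meets the parabola only at its
contact point. -/
theorem cross_parabolaTangent_lt {w u : ℤ × ℤ} (h : cross w u ≠ 0) {k j : ℤ} (hkj : j ≠ k) :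
    cross (parabolaTangent w u k) (parabola w u k) <
      cross (parabolaTangent w u k) (parabola w u j) := by
  rw [cross_parabola, cross_parabola, cross_parabolaTangent_left, cross_parabolaTangent_right]
  have h1 : 0 < cross w u ^ 2 * (j - k) ^ 2 := by
    have := sub_ne_zero.2 hkj
    positivity
  nlinarith

theorem parabola_injective {w u : ℤ × ℤ} (h : cross w u ≠ 0) :
    Function.Injective (parabola w u) := by
  intro k j hkj
  by_contra hne
  have := cross_parabolaTangent_lt h (Ne.symm hne)
  rw [hkj] at this
  exact lt_irrefl _ this

theorem convexChain_parabola_neg_right {w u : ℤ × ℤ} (h : cross w u ≠ 0) :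
    ConvexChain u (parabola w u '' Set.Iio 0) := by
  rintro _ ⟨k, hk, rfl⟩
  refine ⟨parabolaTangent w u k, by rw [cross_parabolaTangent_right]; positivity, ?_⟩
  rintro _ ⟨j, hj, rfl⟩ hne
  exact cross_parabolaTangent_lt h fun e => hne (by rw [e])

/-- The tangent functional at `k` takes the value `-(2 * k) * cross w u ^ 2` on `w`, so the
restriction to negative parameters is what makes `w` a second admissible direction besides the axis.
-/
theorem convexChain_parabola_neg_left {w u : ℤ × ℤ} (h : cross w u ≠ 0) :
    ConvexChain w (parabola w u '' Set.Iio 0) := by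
  rintro _ ⟨k, hk, rfl⟩
  refine ⟨parabolaTangent w u k, ?_, ?_⟩
  · rw [cross_parabolaTangent_left]
    have : 0 < -(2 * k) := by simp only [Set.mem_Iio] at hk; omega
    positivity
  rintro _ ⟨j, hj, rfl⟩ hne
  exact cross_parabolaTangent_lt h fun e => hne (by rw [e])

theorem eventually_quadratic_pos {a : ℤ} (ha : 0 < a) (b c : ℤ) :
    ∀ᶠ k : ℤ in Filter.atTop, 0 < a * k ^ 2 + b * k + c := by
  filter_upwards [Filter.eventually_ge_atTop (|b| + |c| + 1)] with k hk
  have h1 := abs_nonneg b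
  have h2 := abs_nonneg c
  have h3 := neg_abs_le b
  have h4 := neg_abs_le c
  have hk0 : 0 < k := by linarith
  have h5 : k ^ 2 ≤ a * k ^ 2 := by nlinarith
  nlinarith [mul_nonneg h2 (show 0 ≤ k - 1 by linarith)]

/-- Both comparisons between a point of `S` and the parabola point of parameter `k` are quadratic
inequalities in `k`. Their leading coefficients, `cross (δ v) u` and `cross w u ^ 2`, are positive,
and finiteness of `S` makes the threshold uniform. -/
theorem ConvexChain.exists_union_parabola {S : Finset (ℤ × ℤ)} {w u : ℤ × ℤ} (h : cross w u ≠ 0)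
    (hS : ConvexChain u (S : Set (ℤ × ℤ))) :
    ∃ N : ℤ, ConvexChain u ((S : Set (ℤ × ℤ)) ∪ parabola w u '' Set.Ici N) := by
  choose! δ hδu hδ using hS
  have h1 : ∀ᶠ k : ℤ in Filter.atTop, ∀ v ∈ S,
      0 < cross (δ v) u * k ^ 2 + cross (δ v) w * k + -cross (δ v) v :=
    (Filter.eventually_all_finset S).2 fun v hv => eventually_quadratic_pos (hδu v hv) _ _
  have h2 : ∀ᶠ k : ℤ in Filter.atTop, ∀ v ∈ S, 0 < cross w u ^ 2 * k ^ 2 +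
      (2 * cross w u * cross u v) * k + cross w u * cross w v :=
    (Filter.eventually_all_finset S).2 fun v hv => eventually_quadratic_pos (by positivity) _ _
  obtain ⟨N, hN⟩ := Filter.eventually_atTop.1 (h1.and h2)
  refine ⟨N, ?_⟩
  rintro v (hv | ⟨k, hk, rfl⟩)
  · refine ⟨δ v, hδu v hv, ?_⟩
    rintro x (hx | ⟨j, hj, rfl⟩) hne
    · exact hδ v hv x hx hne
    · rw [cross_parabola]
      linarith [(hN j hj).1 v hv]
  · refine ⟨parabolaTangent w u k, by rw [cross_parabolaTangent_right]; positivity, ?_⟩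
    rintro x (hx | ⟨j, hj, rfl⟩) hne
    · have := (hN k hk).2 x hx
      have e : cross (parabolaTangent w u k) x =
          cross w u * cross w x + 2 * cross w u * cross u x * k := by
        simp [cross, parabolaTangent]; ring
      rw [cross_parabola, cross_parabolaTangent_left, cross_parabolaTangent_right, e]
      linarith
    · exact cross_parabolaTangent_lt h fun e => hne (by rw [e])

/-! ### Convex pentagons and hexagons -/

/-- Three-term Plücker relation, as a positivity statement about the triangles at `o`. -/
theorem orient_pos_of_plucker {o a b c d : ℤ × ℤ} (hab : 0 < orient o a b) (hcd : 0 < orient o c d)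
    (had : 0 < orient o a d) (hbc : 0 < orient o b c) (hbd : 0 < orient o b d) :
    0 < orient o a c := by
  have : orient o a c * orient o b d =
      orient o a b * orient o c d + orient o a d * orient o b c := by
    simp only [orient, cross, Prod.fst_sub, Prod.snd_sub]; ring
  have h : 0 < orient o a c * orient o b d := by rw [this]; positivity
  exact pos_of_mul_pos_left h hbd.le

theorem orient_pos_of_plucker' {o a b c d : ℤ × ℤ} (hab : 0 < orient o a b)
    (hcd : 0 < orient o c d) (had : 0 < orient o a d) (hbc : 0 < orient o b c)
    (hac : 0 < orient o a c) : 0 < orient o b d := by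
  have : orient o b d * orient o a c =
      orient o a b * orient o c d + orient o a d * orient o b c := by
    simp only [orient, cross, Prod.fst_sub, Prod.snd_sub]; ring
  have h : 0 < orient o b d * orient o a c := by rw [this]; positivity
  exact pos_of_mul_pos_left h hac.le

theorem orient_rotate (a b c : ℤ × ℤ) : orient b c a = orient a b c := by
  simp only [orient, cross, Prod.fst_sub, Prod.snd_sub]; ring

/-- The points `a`, `b`, `c`, `d`, `e` are the vertices of a convex pentagon, in counterclockwise
order. -/
structure Pentagon (a b c d e : ℤ × ℤ) : Prop where
  abc : 0 < orient a b c
  abd : 0 < orient a b d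
  abe : 0 < orient a b e
  acd : 0 < orient a c d
  ace : 0 < orient a c e
  ade : 0 < orient a d e
  bcd : 0 < orient b c d
  bce : 0 < orient b c e
  bde : 0 < orient b d e
  cde : 0 < orient c d e

theorem Pentagon.rotate {a b c d e : ℤ × ℤ} (h : Pentagon a b c d e) : Pentagon b c d e a where
  abc := h.bcd
  abd := h.bce
  abe := by rw [orient_rotate]; exact h.abc
  acd := h.bde
  ace := by rw [orient_rotate]; exact h.abd
  ade := by rw [orient_rotate]; exact h.abe
  bcd := h.cde
  bce := by rw [orient_rotate]; exact h.acd
  bde := by rw [orient_rotate]; exact h.ace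
  cde := by rw [orient_rotate]; exact h.ade

theorem orient_self_left (a b : ℤ × ℤ) : orient a a b = 0 := by simp [orient, cross]
theorem orient_self_right (a b : ℤ × ℤ) : orient a b b = 0 := by
  simp only [orient, cross]; ring
theorem orient_self_outer (a b : ℤ × ℤ) : orient a b a = 0 := by simp [orient, cross]

theorem ne_of_orient_pos {a b c : ℤ × ℤ} (h : 0 < orient a b c) : a ≠ b ∧ a ≠ c ∧ b ≠ c := by
  refine ⟨?_, ?_, ?_⟩ <;> rintro rfl
  · simp [orient_self_left] at h
  · simp [orient_self_outer] at h
  · simp [orient_self_right] at h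

theorem Pentagon.card {a b c d e : ℤ × ℤ} (h : Pentagon a b c d e) :
    ({a, b, c, d, e} : Finset (ℤ × ℤ)).card = 5 := by
  obtain ⟨h1, h2, h3⟩ := ne_of_orient_pos h.abc
  obtain ⟨h4, h5, h6⟩ := ne_of_orient_pos h.ade
  obtain ⟨-, h7, h8⟩ := ne_of_orient_pos h.bcd
  obtain ⟨-, h9, h10⟩ := ne_of_orient_pos h.bce
  simp [*]

/-- If the lines through the edges `de` and `ab` diverge beyond the edge `ea`, then the vertices
form a convex chain. -/
theorem Pentagon.exists_convexChain {a b c d e : ℤ × ℤ} (h : Pentagon a b c d e)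
    (hdiv : cross (e - d) (b - a) < 0) :
    ∃ u, ConvexChain u (({a, b, c, d, e} : Finset (ℤ × ℤ)) : Set (ℤ × ℤ)) := by
  -- The sum of the directions in which the edges `de` and `ba` leave the pentagon; divergence makes
  -- both edge functionals positive on it.
  set u : ℤ × ℤ := (e - d) - (b - a) with hu
  obtain ⟨h1, h2, h3, h4, h5, h6, h7, h8, h9, h10⟩ := h
  have e1 : cross (b - a) u = -cross (e - d) (b - a) := by
    simp only [hu, cross, Prod.fst_sub, Prod.snd_sub]; ring
  have e2 : cross (e - d) u = -cross (e - d) (b - a) := by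
    simp only [hu, cross, Prod.fst_sub, Prod.snd_sub]; ring
  -- A large multiple of an edge direction, plus a neighbouring one, is positive on `u`.
  have key : ∀ s t : ℤ × ℤ, 0 < cross s u →
      ∃ N : ℤ, 1 ≤ N ∧ 0 < cross (N • s + t) u := by
    intro s t hs
    refine ⟨|cross t u| + 1, by linarith [abs_nonneg (cross t u)], ?_⟩
    have : cross ((|cross t u| + 1) • s + t) u = (|cross t u| + 1) * cross s u + cross t u := by
      generalize |cross t u| + 1 = m
      simp [cross]; ring
    rw [this]
    nlinarith [abs_nonneg (cross t u), neg_abs_le (cross t u)]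
  have fin : ∀ (N : ℤ) (s t v w : ℤ × ℤ), 1 ≤ N → 0 ≤ cross s (w - v) → 0 ≤ cross t (w - v) →
      0 < cross s (w - v) + cross t (w - v) → cross (N • s + t) v < cross (N • s + t) w := by
    intro N s t v w hN hs ht hst
    have : cross (N • s + t) w - cross (N • s + t) v =
        N * cross s (w - v) + cross t (w - v) := by
      simp [cross]; ring
    nlinarith
  obtain ⟨N₁, hN₁, hu₁⟩ := key (b - a) (a - e) (by linarith)
  obtain ⟨N₂, hN₂, hu₂⟩ := key (b - a) (c - b) (by linarith)
  obtain ⟨N₄, hN₄, hu₄⟩ := key (e - d) (d - c) (by linarith)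
  obtain ⟨N₅, hN₅, hu₅⟩ := key (e - d) (a - e) (by linarith)
  have hu₃ : 0 < cross (d - b) u := by
    have : cross (d - b) u = orient a b d + orient b d e := by
      simp only [hu, orient, cross, Prod.fst_sub, Prod.snd_sub]; ring
    linarith
  refine ⟨u, ?_⟩
  clear_value u
  clear key hu e1 e2 hdiv
  simp only [orient, cross, Prod.fst_sub, Prod.snd_sub] at h1 h2 h3 h4 h5 h6 h7 h8 h9 h10
  simp only [ConvexChain, Finset.coe_insert, Finset.coe_singleton, Set.mem_insert_iff,
    Set.mem_singleton_iff, forall_eq_or_imp, forall_eq]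
  -- Each functional combines the two edges at its vertex. At `a`, `b`, `d`, `e`, the edge `ab` or
  -- `de` gets a large weight to ensure positivity on `u`; at `c`, the plain sum `d - b` suffices.
  refine ⟨⟨N₁ • (b - a) + (a - e), hu₁, ?_⟩, ⟨N₂ • (b - a) + (c - b), hu₂, ?_⟩,
    ⟨d - b, hu₃, ?_⟩, ⟨N₄ • (e - d) + (d - c), hu₄, ?_⟩, ⟨N₅ • (e - d) + (a - e), hu₅, ?_⟩⟩
  · refine ⟨fun h => absurd rfl h, ?_, ?_, ?_, ?_⟩ <;> intro _ <;>
      refine fin _ _ _ _ _ hN₁ ?_ ?_ ?_ <;> simp only [cross, Prod.fst_sub, Prod.snd_sub] <;>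
      linarith
  · refine ⟨?_, fun h => absurd rfl h, ?_, ?_, ?_⟩ <;> intro _ <;>
      refine fin _ _ _ _ _ hN₂ ?_ ?_ ?_ <;> simp only [cross, Prod.fst_sub, Prod.snd_sub] <;>
      linarith
  · refine ⟨?_, ?_, fun h => absurd rfl h, ?_, ?_⟩ <;> intro _ <;>
      simp only [cross, Prod.fst_sub, Prod.snd_sub] <;> linarith
  · refine ⟨?_, ?_, ?_, fun h => absurd rfl h, ?_⟩ <;> intro _ <;>
      refine fin _ _ _ _ _ hN₄ ?_ ?_ ?_ <;> simp only [cross, Prod.fst_sub, Prod.snd_sub] <;>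
      linarith
  · refine ⟨?_, ?_, ?_, ?_, fun h => absurd rfl h⟩ <;> intro _ <;>
      refine fin _ _ _ _ _ hN₅ ?_ ?_ ?_ <;> simp only [cross, Prod.fst_sub, Prod.snd_sub] <;>
      linarith

/-- The points `a`, `b`, `c`, `d`, `e`, `f` are the vertices of a convex hexagon, in
counterclockwise order. -/
structure Hexagon (a b c d e f : ℤ × ℤ) : Prop where
  abcde : Pentagon a b c d e
  abf : 0 < orient a b f
  acf : 0 < orient a c f
  adf : 0 < orient a d f
  aef : 0 < orient a e f
  bcf : 0 < orient b c f
  bdf : 0 < orient b d f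
  bef : 0 < orient b e f
  cdf : 0 < orient c d f
  cef : 0 < orient c e f
  dEf : 0 < orient d e f

theorem Hexagon.convexPosition {a b c d e f : ℤ × ℤ} (h : Hexagon a b c d e f) :
    ConvexPosition (({a, b, c, d, e, f} : Finset (ℤ × ℤ)) : Set (ℤ × ℤ)) := by
  apply convexPosition_of_cross
  obtain ⟨⟨h1, h2, h3, h4, h5, h6, h7, h8, h9, h10⟩, h11, h12, h13, h14, h15, h16, h17, h18, h19,
    h20⟩ := h
  simp only [orient, cross, Prod.fst_sub, Prod.snd_sub] at *
  simp only [Finset.coe_insert, Finset.coe_singleton, Set.mem_insert_iff,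
    Set.mem_singleton_iff, forall_eq_or_imp, forall_eq]
  -- At each vertex, the supporting line is taken parallel to the diagonal joining its two
  -- neighbours.
  refine ⟨⟨b - f, ?_⟩, ⟨c - a, ?_⟩, ⟨d - b, ?_⟩, ⟨e - c, ?_⟩, ⟨f - d, ?_⟩, ⟨a - e, ?_⟩⟩ <;>
    refine ⟨?_, ?_, ?_, ?_, ?_, ?_⟩ <;> intro hne <;>
    first
    | exact absurd rfl hne
    | (simp only [Prod.fst_sub, Prod.snd_sub]; linarith)

/-- A point `x` beyond the edge `ab` of a convex pentagon, but between the lines through the two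
neighbouring edges, can be inserted. -/
theorem Pentagon.hexagon {a b c d e x : ℤ × ℤ} (h : Pentagon a b c d e)
    (h1 : 0 < orient e a x) (h2 : 0 < orient a x b) (h3 : 0 < orient b c x) :
    Hexagon a x b c d e := by
  have axe : 0 < orient a x e := by rwa [orient_rotate]
  have xbc : 0 < orient x b c := by rwa [← orient_rotate]
  have bax : 0 < orient b a x := by rwa [← orient_rotate]
  have axc : 0 < orient a x c := orient_pos_of_plucker h2 h.ace axe h.abc h.abe
  have axd : 0 < orient a x d := orient_pos_of_plucker h2 h.ade axe h.abd h.abe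
  have bca := h.rotate.abe
  have bda := h.rotate.ace
  have bea := h.rotate.ade
  have bdx : 0 < orient b d x := orient_pos_of_plucker' h.bcd bax h3 bda bca
  have bex : 0 < orient b e x := orient_pos_of_plucker' h.bce bax h3 bea bca
  have cxb : 0 < orient c x b := by rwa [← orient_rotate] at h3 ⊢
  have cax : 0 < orient c a x := by rwa [← orient_rotate]
  have hc := h.rotate.rotate
  have cdx : 0 < orient c d x := orient_pos_of_plucker hc.abd cxb hc.abe cax hc.ade
  have cex : 0 < orient c e x := orient_pos_of_plucker hc.acd cxb hc.ace cax hc.ade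
  have hd := hc.rotate
  have dxc : 0 < orient d x c := by rwa [orient_rotate]
  have dax : 0 < orient d a x := by rwa [← orient_rotate]
  have dex : 0 < orient d e x := orient_pos_of_plucker hd.abc dxc hd.abe dax hd.ace
  have rot : ∀ {p q : ℤ × ℤ}, 0 < orient p q x → 0 < orient x p q := fun hpq => by
    rwa [← orient_rotate]
  exact ⟨⟨h2, axc, axd, h.abc, h.abd, h.acd, xbc, rot bdx, rot cdx, h.bcd⟩, axe, h.abe, h.ace,
    h.ade, rot bex, rot cex, rot dex, h.bce, h.bde, h.cde⟩

/-- The pentagon obtained by deleting the first vertex of a hexagon. -/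
theorem Hexagon.delete_first {a b c d e f : ℤ × ℤ} (h : Hexagon a b c d e f) :
    Pentagon b c d e f :=
  ⟨h.abcde.bcd, h.abcde.bce, h.bcf, h.abcde.bde, h.bdf, h.bef, h.abcde.cde, h.cdf, h.cef, h.dEf⟩

/-- The pentagon obtained by deleting the fifth vertex of a hexagon. -/
theorem Hexagon.delete_fifth {a b c d e f : ℤ × ℤ} (h : Hexagon a b c d e f) :
    Pentagon a b c d f :=
  ⟨h.abcde.abc, h.abcde.abd, h.abf, h.abcde.acd, h.acf, h.adf, h.abcde.bcd, h.bcf, h.bdf, h.cdf⟩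

/-- The golden ratio is irrational. -/
theorem not_golden {p q : ℤ} (hp : p ≠ 0) : p ^ 2 ≠ q ^ 2 + q * p := by
  intro h
  -- Completing the square exhibits a rational square root of 5.
  have h5 : (2 * q + p) ^ 2 = 5 * p ^ 2 := by linarith
  have hirr : Irrational (√(5 : ℝ)) := by
    simpa using Nat.Prime.irrational_sqrt (show Nat.Prime 5 by norm_num)
  apply hirr
  refine ⟨|(2 * q + p : ℚ) / p|, ?_⟩
  have hp' : (p : ℝ) ≠ 0 := by exact_mod_cast hp
  have h5' : ((2 * q + p) / p : ℝ) ^ 2 = 5 := by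
    rw [div_pow, div_eq_iff (by positivity)]
    exact_mod_cast h5
  rw [← h5', Real.sqrt_sq_eq_abs]
  push_cast
  rfl

/-- `S` and `T` are contained in a common finite set in convex position. -/
def PentagonSwap (S T : Finset (ℤ × ℤ)) : Prop :=
  ∃ W : Finset (ℤ × ℤ), ConvexPosition (W : Set (ℤ × ℤ)) ∧ S ⊆ W ∧ T ⊆ W

/-- A set of five points that is a convex chain, or becomes one after exchanging a vertex. -/
def NearChain (S : Finset (ℤ × ℤ)) : Prop :=
  ∃ T u, PentagonSwap S T ∧ T.card = 5 ∧ ConvexChain u (T : Set (ℤ × ℤ))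

/-! ### Turning a lattice pentagon into a convex chain -/

theorem Pentagon.nearChain_of_cross_neg {a b c d e : ℤ × ℤ} (h : Pentagon a b c d e)
    (hdiv : cross (e - d) (b - a) < 0) : NearChain {a, b, c, d, e} := by
  obtain ⟨u, hu⟩ := h.exists_convexChain hdiv
  exact ⟨_, u, ⟨_, hu.convexPosition, subset_rfl, subset_rfl⟩, h.card, hu⟩

/-- In the strip between the parallel lines `ea` and `bc`, a point `x` far beyond `ab` can be
inserted. Once `a` is deleted, the edges `de` and `xb` diverge beyond `ex`. -/
theorem Pentagon.nearChain_of_cross_eq_zero {a b c d e : ℤ × ℤ} (h : Pentagon a b c d e)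
    (hpar : cross (a - e) (c - b) = 0) : NearChain {a, b, c, d, e} := by
  have hd := h.rotate.rotate.rotate
  have he := hd.rotate
  -- Large enough both for `x` to pass beyond `ab` and for `xb` to diverge from `de`.
  set k : ℤ := |orient a b d| + |cross (e - d) (b - d)| + 1 with hk
  have hk1 : orient a b d < k * orient e a b := by
    have := he.abc
    have := le_abs_self (orient a b d)
    have := abs_nonneg (cross (e - d) (b - d))
    have := abs_nonneg (orient a b d)
    nlinarith
  have hk2 : cross (e - d) (b - d) < k * orient d e a := by
    have := hd.abc
    have := le_abs_self (cross (e - d) (b - d))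
    have := abs_nonneg (cross (e - d) (b - d))
    have := abs_nonneg (orient a b d)
    nlinarith
  clear_value k
  set x : ℤ × ℤ := d + k • (a - e) with hx
  have e1 : orient e a x = orient e a d := by
    simp [hx, orient, cross]; ring
  have e2 : orient a x b = k * orient e a b - orient a b d := by
    simp [hx, orient, cross]; ring
  have e3 : orient b c x = orient b c d - k * cross (a - e) (c - b) := by
    simp [hx, orient, cross]; ring
  have e4 : cross (e - d) (b - x) = cross (e - d) (b - d) - k * orient d e a := by
    simp [hx, orient, cross]; ring
  have H : Hexagon a x b c d e := h.hexagon (by rw [e1]; exact he.abe) (by linarith)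
    (by rw [e3, hpar]; simpa using h.bcd)
  have P := H.delete_first
  obtain ⟨u, hu⟩ := P.exists_convexChain (by linarith)
  refine ⟨_, u, ⟨_, H.convexPosition, ?_, ?_⟩, P.card, hu⟩ <;> intro y <;> simp <;> tauto

/-- The lines `ea` and `bc` meet beyond `ab`, hence diverge on the other side. Deleting `d` makes
them the neighbours of the edge `ce`, provided that a lattice point can first be inserted beyond
`ab`. The area inequality places `b + e - d` in the required triangle. -/
theorem Pentagon.nearChain_of_orient_lt {a b c d e : ℤ × ℤ} (h : Pentagon a b c d e)
    (hab : 0 < cross (a - e) (c - b)) (hea : 0 < cross (e - d) (b - a))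
    (hcd : 0 < cross (c - b) (e - d))
    (hlt : orient d e a < orient e a b) : NearChain {a, b, c, d, e} := by
  set x : ℤ × ℤ := b + e - d with hx
  have e1 : orient e a x = orient e a b - orient d e a := by
    simp [hx, orient, cross]; ring
  have e2 : orient a x b = cross (e - d) (b - a) := by
    simp [hx, orient, cross]; ring
  have e3 : orient b c x = cross (c - b) (e - d) := by
    simp [hx, orient, cross]; ring
  have H : Hexagon a x b c d e := h.hexagon (by linarith) (by linarith) (by linarith)
  have P := H.delete_fifth.rotate.rotate.rotate.rotate
  have e4 : cross (c - b) (a - e) = -cross (a - e) (c - b) := by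
    simp [cross]; ring
  obtain ⟨u, hu⟩ := P.exists_convexChain (by linarith)
  refine ⟨_, u, ⟨_, H.convexPosition, ?_, ?_⟩, P.card, hu⟩ <;> intro y <;> simp <;> tauto

theorem Pentagon.nearChain {a b c d e : ℤ × ℤ} (h : Pentagon a b c d e) :
    NearChain {a, b, c, d, e} := by
  have hb := h.rotate
  have hc := hb.rotate
  have hd := hc.rotate
  have he := hd.rotate
  have rb : ({b, c, d, e, a} : Finset (ℤ × ℤ)) = {a, b, c, d, e} := by ext; simp; tauto
  have rc : ({c, d, e, a, b} : Finset (ℤ × ℤ)) = {a, b, c, d, e} := by ext; simp; tauto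
  have rd : ({d, e, a, b, c} : Finset (ℤ × ℤ)) = {a, b, c, d, e} := by ext; simp; tauto
  have re : ({e, a, b, c, d} : Finset (ℤ × ℤ)) = {a, b, c, d, e} := by ext; simp; tauto
  by_contra hcon
  have aux : ∀ {a' b' c' d' e' : ℤ × ℤ}, Pentagon a' b' c' d' e' →
      ({a', b', c', d', e'} : Finset (ℤ × ℤ)) = {a, b, c, d, e} →
      0 < cross (e' - d') (b' - a') := by
    intro a' b' c' d' e' h' heq
    rcases lt_trichotomy (cross (e' - d') (b' - a')) 0 with h0 | h0 | h0
    · exact absurd (heq ▸ h'.nearChain_of_cross_neg h0) hcon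
    · refine absurd ?_ hcon
      have := h'.rotate.rotate.rotate.rotate.nearChain_of_cross_eq_zero h0
      rw [← heq]
      convert this using 1
      ext; simp; tauto
    · exact h0
  have qea := aux h rfl
  have qab := aux hb rb
  have qbc := aux hc rc
  have qcd := aux hd rd
  have qde := aux he re
  -- The five inequalities are cyclic, so all five areas are equal.
  have la : orient e a b ≤ orient d e a :=
    not_lt.1 fun hlt => hcon (h.nearChain_of_orient_lt qab qea qcd hlt)
  have lb : orient a b c ≤ orient e a b :=
    not_lt.1 fun hlt => hcon (rb ▸ hb.nearChain_of_orient_lt qbc qab qde hlt)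
  have lc : orient b c d ≤ orient a b c :=
    not_lt.1 fun hlt => hcon (rc ▸ hc.nearChain_of_orient_lt qcd qbc qea hlt)
  have ld : orient c d e ≤ orient b c d :=
    not_lt.1 fun hlt => hcon (rd ▸ hd.nearChain_of_orient_lt qde qcd qab hlt)
  have le : orient d e a ≤ orient c d e :=
    not_lt.1 fun hlt => hcon (re ▸ he.nearChain_of_orient_lt qea qde qbc hlt)
  have p1 : orient e a b = orient a b c := by linarith
  have p2 : orient b c d = orient a b c := by linarith
  have p3 : orient c d e = orient a b c := by linarith
  have p4 : orient d e a = orient a b c := by linarith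
  apply not_golden (p := orient a b c) (q := cross (b - a) (d - c)) h.abc.ne'
  -- The Plücker relation between four consecutive edge vectors. Below, `s1` and `s2` each compute
  -- the area of one triangle (`abd`, then `deb`) in two ways.
  have plucker : orient a b c * orient c d e = cross (b - a) (d - c) * cross (c - b) (e - d) +
      cross (e - d) (b - a) * orient b c d := by
    simp only [orient, cross, Prod.fst_sub, Prod.snd_sub]; ring
  have s1 : orient a b c + cross (b - a) (d - c) = cross (e - d) (b - a) + orient e a b := by
    simp only [orient, cross, Prod.fst_sub, Prod.snd_sub]; ring
  have s2 : orient d e a + cross (e - d) (b - a) = cross (c - b) (e - d) + orient c d e := by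
    simp only [orient, cross, Prod.fst_sub, Prod.snd_sub]; ring
  have q1 : cross (e - d) (b - a) = cross (b - a) (d - c) := by linarith
  have q2 : cross (c - b) (e - d) = cross (b - a) (d - c) := by linarith
  rw [p3, p2, q1, q2] at plucker
  linarith

/-! ### Sorting five points in convex position -/

/-- If the points were collinear, the functional minimised at `a` would put `b` and `c` on one ray
from `a`; the nearer of the two would lie between the others and minimise nothing strictly. -/
theorem ConvexPosition.orient_ne_zero {S : Set (ℤ × ℤ)} (h : ConvexPosition S) {a b c : ℤ × ℤ}
    (ha : a ∈ S) (hb : b ∈ S) (hc : c ∈ S) (hab : a ≠ b) (hac : a ≠ c) (hbc : b ≠ c) :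
    orient a b c ≠ 0 := by
  intro h0
  have h0' : ((b.1 - a.1) * (c.2 - a.2) - (b.2 - a.2) * (c.1 - a.1) : ℝ) = 0 := by
    simp only [orient, cross, Prod.fst_sub, Prod.snd_sub] at h0
    exact_mod_cast h0
  obtain ⟨p, q, hf⟩ := h a ha
  have h1 := hf b hb hab.symm
  have h2 := hf c hc hac.symm
  set β : ℝ := p * (b.1 - a.1) + q * (b.2 - a.2) with hβ
  set γ : ℝ := p * (c.1 - a.1) + q * (c.2 - a.2) with hγ
  have hβ0 : 0 < β := by linarith
  have hγ0 : 0 < γ := by linarith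
  have r1 : γ * (b.1 - a.1) = β * (c.1 - a.1) := by
    rw [hβ, hγ]; linear_combination q * h0'
  have r2 : γ * (b.2 - a.2) = β * (c.2 - a.2) := by
    rw [hβ, hγ]; linear_combination (-p) * h0'
  clear_value β γ
  rcases lt_trichotomy β γ with hlt | heq | hlt
  · obtain ⟨p', q', hg⟩ := h b hb
    have g1 := hg a ha hab
    have g2 := hg c hc hbc.symm
    have e : γ * (p' * (b.1 - a.1) + q' * (b.2 - a.2)) =
        β * (p' * (c.1 - a.1) + q' * (c.2 - a.2)) := by linear_combination p' * r1 + q' * r2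
    nlinarith
  · subst heq
    apply hbc
    have e1 := mul_left_cancel₀ hβ0.ne' r1
    have e2 := mul_left_cancel₀ hβ0.ne' r2
    ext
    · exact_mod_cast (sub_left_inj.1 e1)
    · exact_mod_cast (sub_left_inj.1 e2)
  · obtain ⟨p', q', hg⟩ := h c hc
    have g1 := hg a ha hac
    have g2 := hg b hb hbc
    have e : γ * (p' * (b.1 - a.1) + q' * (b.2 - a.2)) =
        β * (p' * (c.1 - a.1) + q' * (c.2 - a.2)) := by linear_combination p' * r1 + q' * r2
    nlinarith

/-- Otherwise the affine dependence between the four points writes `c` as a convex combination of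
`a`, `b`, `d`, so `c` is not a strict minimiser. -/
theorem ConvexPosition.orient_pos {S : Set (ℤ × ℤ)} (h : ConvexPosition S) {a b c d : ℤ × ℤ}
    (ha : a ∈ S) (hb : b ∈ S) (hc : c ∈ S) (hd : d ∈ S)
    (habc : 0 < orient a b c) (hacd : 0 < orient a c d) :
    0 < orient b c d := by
  by_contra hneg
  obtain ⟨-, -, hbc⟩ := ne_of_orient_pos habc
  obtain ⟨hac, -, hcd⟩ := ne_of_orient_pos hacd
  obtain ⟨p, q, hf⟩ := h c hc
  have f1 := hf a ha hac
  have f2 := hf b hb hbc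
  have f3 := hf d hd hcd.symm
  have k1 : (0 : ℝ) < orient a b c := by exact_mod_cast habc
  have k2 : (0 : ℝ) < orient a c d := by exact_mod_cast hacd
  have k3 : (0 : ℝ) ≤ -orient b c d := by
    have : (orient b c d : ℝ) ≤ 0 := by exact_mod_cast not_lt.1 hneg
    linarith
  have m1 := mul_nonneg k3 (sub_pos.2 f1).le
  have m2 := mul_pos k2 (sub_pos.2 f2)
  have m3 := mul_pos k1 (sub_pos.2 f3)
  simp only [orient, cross, Prod.fst_sub, Prod.snd_sub] at m1 m2 m3
  push_cast at m1 m2 m3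
  linarith

theorem ConvexPosition.exists_pentagon {S : Finset (ℤ × ℤ)}
    (h : ConvexPosition (S : Set (ℤ × ℤ))) (hcard : S.card = 5) :
    ∃ a b c d e, S = {a, b, c, d, e} ∧ Pentagon a b c d e := by
  obtain ⟨a, ha⟩ : S.Nonempty := Finset.card_pos.1 (by omega)
  have hcard' : (S.erase a).card = 4 := by rw [Finset.card_erase_of_mem ha, hcard]
  obtain ⟨p, q, hf⟩ := h a ha
  -- The tangent of the angle at `a` measured from `(p, q)`. All other points lie in the open
  -- half-plane where the denominator is positive, so sorting by `m` is sorting counterclockwise.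
  let m : ℤ × ℤ → ℝ := fun w => (-q * (w.1 - a.1) + p * (w.2 - a.2)) /
    (p * (w.1 - a.1) + q * (w.2 - a.2))
  let ε := ((S.erase a).equivFinOfCardEq hcard').symm
  let σ := Tuple.sort fun i => m (ε i)
  let v : Fin 4 → ℤ × ℤ := fun i => ε (σ i)
  have hmono : Monotone fun i => m (v i) := Tuple.monotone_sort fun i => m (ε i)
  have hinj : Function.Injective v := fun i j hij =>
    σ.injective (ε.injective (Subtype.ext hij))
  have hmem : ∀ i, v i ∈ S.erase a := fun i => (ε (σ i)).2
  have hS : ∀ i, v i ∈ (S : Set (ℤ × ℤ)) := fun i => Finset.mem_of_mem_erase (hmem i)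
  have hne : ∀ i, v i ≠ a := fun i => Finset.ne_of_mem_erase (hmem i)
  have hpos : ∀ i j, i < j → 0 < orient a (v i) (v j) := by
    intro i j hij
    refine lt_of_le_of_ne ?_ (h.orient_ne_zero ha (hS i) (hS j) (hne i).symm (hne j).symm
      (hinj.ne hij.ne)).symm
    have hm : m (v i) ≤ m (v j) := hmono hij.le
    have fi := hf _ (hS i) (hne i)
    have fj := hf _ (hS j) (hne j)
    rw [div_le_div_iff₀ (by linarith) (by linarith)] at hm
    have hpq : 0 < p ^ 2 + q ^ 2 := by
      by_contra hle
      have hp : p = 0 := by nlinarith [sq_nonneg p, sq_nonneg q]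
      have hq : q = 0 := by nlinarith [sq_nonneg p, sq_nonneg q]
      simp [hp, hq] at fi
    have key : 0 ≤ (p ^ 2 + q ^ 2) * ((orient a (v i) (v j) : ℤ) : ℝ) := by
      simp only [orient, cross, Prod.fst_sub, Prod.snd_sub]
      push_cast
      linarith
    exact_mod_cast nonneg_of_mul_nonneg_right key hpq
  have hpos' : ∀ i j k, i < j → j < k → 0 < orient (v i) (v j) (v k) := fun i j k hij hjk =>
    h.orient_pos ha (hS i) (hS j) (hS k) (hpos i j hij) (hpos j k hjk)
  have hP : Pentagon a (v 0) (v 1) (v 2) (v 3) :=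
    ⟨hpos _ _ (by decide), hpos _ _ (by decide), hpos _ _ (by decide), hpos _ _ (by decide),
      hpos _ _ (by decide), hpos _ _ (by decide), hpos' _ _ _ (by decide) (by decide),
      hpos' _ _ _ (by decide) (by decide), hpos' _ _ _ (by decide) (by decide),
      hpos' _ _ _ (by decide) (by decide)⟩
  refine ⟨a, v 0, v 1, v 2, v 3, (Finset.eq_of_subset_of_card_le ?_ ?_).symm, hP⟩
  · intro x hx
    simp only [Finset.mem_insert, Finset.mem_singleton] at hx
    rcases hx with rfl | rfl | rfl | rfl | rfl
    exacts [ha, hS 0, hS 1, hS 2, hS 3]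
  · rw [hP.card, hcard]

/-! ### Lattice polytopes from point sets in convex position -/

/-- A point of `ℤ²`, viewed in the Euclidean plane. -/
noncomputable def latticePoint (v : ℤ × ℤ) : EuclideanSpace ℝ (Fin 2) := !₂[(v.1 : ℝ), (v.2 : ℝ)]

@[simp] theorem latticePoint_zero (v : ℤ × ℤ) : latticePoint v 0 = v.1 := rfl
@[simp] theorem latticePoint_one (v : ℤ × ℤ) : latticePoint v 1 = v.2 := rfl

theorem latticePoint_injective : Function.Injective latticePoint := by
  intro v w h
  have h0 := congrArg (fun x => x 0) h
  have h1 := congrArg (fun x => x 1) h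
  simp only [latticePoint_zero, latticePoint_one, Int.cast_inj] at h0 h1
  exact Prod.ext h0 h1

/-- The convex hull of a set of lattice points. -/
noncomputable abbrev latticeHull (S : Finset (ℤ × ℤ)) : Set (EuclideanSpace ℝ (Fin 2)) :=
  convexHull ℝ (latticePoint '' S)

theorem convex_insert_halfspace {E : Type*} [AddCommGroup E] [Module ℝ E] (f : E →ₗ[ℝ] ℝ) (v : E) :
    Convex ℝ {x | x = v ∨ f v < f x} := by
  intro x hx y hy s t hs ht hst
  rcases hs.eq_or_lt with rfl | hs
  · obtain rfl : t = 1 := by linarith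
    simpa using hy
  rcases ht.eq_or_lt with rfl | ht
  · obtain rfl : s = 1 := by linarith
    simpa using hx
  have hv : f v = s * f v + t * f v := by rw [← add_mul, hst, one_mul]
  simp only [Set.mem_ofPred_eq, map_add, map_smul, smul_eq_mul] at hx hy ⊢
  rcases hx with rfl | hx <;> rcases hy with rfl | hy
  · left; rw [← add_smul, hst, one_smul]
  · right; nlinarith
  · right; nlinarith
  · right; nlinarith

/-- An open half-space with one boundary point adjoined is convex, so strict minimality at `v`
passes from `A` to its hull. -/
theorem mem_extremePoints_convexHull_of_lt {E : Type*} [AddCommGroup E] [Module ℝ E] {A : Set E}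
    (f : E →ₗ[ℝ] ℝ) {v : E} (hv : v ∈ A) (hf : ∀ x ∈ A, x ≠ v → f v < f x) :
    v ∈ (convexHull ℝ A).extremePoints ℝ := by
  have hsub : convexHull ℝ A ⊆ {x | x = v ∨ f v < f x} :=
    convexHull_min (fun x hx => or_iff_not_imp_left.2 (hf x hx)) (convex_insert_halfspace f v)
  rw [mem_extremePoints_iff_left]
  refine ⟨subset_convexHull ℝ A hv, fun x hx y hy hxy => ?_⟩
  rcases hsub hx with h | h
  · exact h
  · exfalso
    obtain ⟨s, t, hs, ht, hst, rfl⟩ := hxy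
    have hv : f (s • x + t • y) = s * f (s • x + t • y) + t * f (s • x + t • y) := by
      rw [← add_mul, hst, one_mul]
    have hy' : f (s • x + t • y) ≤ f y := by
      rcases hsub hy with h' | h'
      · exact (congrArg f h').ge
      · exact h'.le
    have e : f (s • x + t • y) = s * f x + t * f y := by simp
    nlinarith

/-- The linear functional on the plane with given coefficients. -/
noncomputable def planeFunctional (p q : ℝ) : EuclideanSpace ℝ (Fin 2) →ₗ[ℝ] ℝ where
  toFun x := p * x 0 + q * x 1
  map_add' x y := by simp; ring
  map_smul' c x := by simp; ring

theorem ConvexPosition.extremePoints_latticeHull {S : Finset (ℤ × ℤ)}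
    (h : ConvexPosition (S : Set (ℤ × ℤ))) :
    (latticeHull S).extremePoints ℝ = latticePoint '' S := by
  refine extremePoints_convexHull_subset.antisymm ?_
  rintro _ ⟨v, hv, rfl⟩
  obtain ⟨p, q, hf⟩ := h v hv
  refine mem_extremePoints_convexHull_of_lt (planeFunctional p q) ⟨v, hv, rfl⟩ ?_
  rintro _ ⟨w, hw, rfl⟩ hne
  exact hf w hw fun e => hne (by rw [e])

/-- Among three collinear points one lies between the others and cannot be a strict minimiser, so
any three points of `S` are affinely independent. -/
theorem ConvexPosition.affineSpan_latticeHull {S : Finset (ℤ × ℤ)}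
    (h : ConvexPosition (S : Set (ℤ × ℤ))) (hcard : 3 ≤ S.card) :
    affineSpan ℝ (latticeHull S) = ⊤ := by
  obtain ⟨a, b, c, ha, hb, hc, hab, hac, hbc⟩ := Finset.two_lt_card_iff.1 hcard
  have key : ∀ x y z : ℤ × ℤ, x ∈ S → y ∈ S → z ∈ S → x ≠ y → z ≠ y →
      ¬ Wbtw ℝ (latticePoint x) (latticePoint y) (latticePoint z) := by
    rintro x y z hx hy hz hxy hzy hw
    obtain ⟨p, q, hf⟩ := h y hy
    have hsub : segment ℝ (latticePoint x) (latticePoint z) ⊆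
        {v | planeFunctional p q (latticePoint y) < planeFunctional p q v} :=
      (convex_halfSpace_gt (planeFunctional p q).isLinear _).segment_subset
        (hf x hx hxy) (hf z hz hzy)
    simpa using hsub (mem_segment_iff_wbtw.2 hw)
  have hcol : ¬ Collinear ℝ {latticePoint a, latticePoint b, latticePoint c} := by
    intro hcol
    rcases hcol.wbtw_or_wbtw_or_wbtw with hw | hw | hw
    · exact key _ _ _ ha hb hc hab hbc.symm hw
    · exact key _ _ _ hb hc ha hbc hac hw
    · exact key _ _ _ hc ha hb hac.symm hab.symm hw
  have hind := affineIndependent_iff_not_collinear_set.2 hcol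
  have htop := hind.affineSpan_eq_top_iff_card_eq_finrank_add_one.2 (by simp)
  rw [eq_top_iff, ← htop]
  refine affineSpan_mono ℝ ?_
  rintro _ ⟨i, rfl⟩
  apply subset_convexHull
  fin_cases i
  exacts [⟨a, ha, rfl⟩, ⟨b, hb, rfl⟩, ⟨c, hc, rfl⟩]

/-- The lattice polygon with a given vertex set. -/
noncomputable def latticePolygon (S : Finset (ℤ × ℤ)) (h : ConvexPosition (S : Set (ℤ × ℤ)))
    (hcard : S.card = 5 ∨ S.card = 6) : FullPolytope 2 where
  carrier := latticeHull S
  isPolytope := ⟨S.image latticePoint, by rw [Finset.coe_image]⟩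
  fullDim := h.affineSpan_latticeHull (by omega)

theorem vertices_latticePolygon {S : Finset (ℤ × ℤ)} (h : ConvexPosition (S : Set (ℤ × ℤ)))
    (hcard : S.card = 5 ∨ S.card = 6) :
    (latticePolygon S h hcard).vertices = latticePoint '' S :=
  h.extremePoints_latticeHull

theorem FullPolytope.ext_carrier {d : ℕ} {P Q : FullPolytope d} (h : P.carrier = Q.carrier) :
    P = Q := by
  cases P; cases Q; congr

/-- The lattice pentagons and hexagons, as vertices of the graph on all lattice polygons. -/
abbrev pentagonsHexagons : Set {P : FullPolytope 2 // P.IsLattice} :=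
  {P | P.1.vertices.ncard = 5 ∨ P.1.vertices.ncard = 6}

/-- The lattice polygon with a given vertex set, as a vertex of the graph. -/
noncomputable def polygonNode (S : Finset (ℤ × ℤ)) (h : ConvexPosition (S : Set (ℤ × ℤ)))
    (hcard : S.card = 5 ∨ S.card = 6) : pentagonsHexagons :=
  ⟨⟨latticePolygon S h hcard, by
    rw [FullPolytope.IsLattice, vertices_latticePolygon]
    rintro _ ⟨v, -, rfl⟩ i
    fin_cases i
    exacts [⟨v.1, rfl⟩, ⟨v.2, rfl⟩]⟩, by
    simpa [pentagonsHexagons, vertices_latticePolygon, Set.ncard_image_of_injective _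
      latticePoint_injective] using hcard⟩

/-- A polytope is the hull of its extreme points by Krein–Milman, with no closure needed as they are
finitely many. Hahn–Banach separation of a vertex from the hull of the others gives the functional
for convex position. -/
theorem exists_polygonNode (P : pentagonsHexagons) : ∃ S h hcard, P = polygonNode S h hcard := by
  obtain ⟨⟨P, hlat⟩, hcard⟩ := P
  have hfin : P.vertices.Finite := Set.finite_of_ncard_pos (by
    rcases hcard with h | h <;> simp only at h <;> omega)
  have hrange : P.vertices ⊆ Set.range latticePoint := by
    intro v hv
    obtain ⟨z, hz⟩ := hlat v hv 0
    obtain ⟨z', hz'⟩ := hlat v hv 1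
    refine ⟨(z, z'), ?_⟩
    ext i
    fin_cases i
    exacts [hz.symm, hz'.symm]
  obtain ⟨S, hS⟩ : ∃ S : Finset (ℤ × ℤ), latticePoint '' S = P.vertices := by
    refine ⟨(hfin.preimage latticePoint_injective.injOn).toFinset, ?_⟩
    rw [Set.Finite.coe_toFinset, Set.image_preimage_eq_of_subset hrange]
  obtain ⟨A, hA⟩ := P.isPolytope
  have hcarrier : latticeHull S = P.carrier := by
    have hcl := closure_convexHull_extremePoints (s := P.carrier)
      (by rw [hA]; exact A.finite_toSet.isCompact_convexHull ℝ)
      (by rw [hA]; exact convex_convexHull _ _)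
    rw [latticeHull, hS, ← hcl, IsClosed.closure_eq]
    · rfl
    · exact (hfin.isCompact_convexHull ℝ).isClosed
  have hconv : ConvexPosition (S : Set (ℤ × ℤ)) := by
    intro v hv
    have hvx : latticePoint v ∈ P.carrier.extremePoints ℝ := by
      have : latticePoint v ∈ P.vertices := hS ▸ ⟨v, hv, rfl⟩
      exact this
    have hnot : latticePoint v ∉
        convexHull ℝ (latticePoint '' (S : Set (ℤ × ℤ)) \ {latticePoint v}) := by
      rw [← hcarrier,
        (convex_convexHull ℝ _).mem_extremePoints_iff_mem_sdiff_convexHull_sdiff] at hvx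
      exact fun hmem => hvx.2
        (convexHull_mono (Set.sdiff_subset_sdiff_left (subset_convexHull ℝ _)) hmem)
    obtain ⟨f, u, hfv, hfu⟩ := geometric_hahn_banach_point_closed (convex_convexHull ℝ _)
      (((S.finite_toSet.image latticePoint).subset Set.sdiff_subset).isCompact_convexHull ℝ).isClosed
      hnot
    refine ⟨f (EuclideanSpace.single 0 1), f (EuclideanSpace.single 1 1), fun w hw hne => ?_⟩
    have hexp : ∀ x : ℤ × ℤ, f (latticePoint x) =
        f (EuclideanSpace.single 0 1) * x.1 + f (EuclideanSpace.single 1 1) * x.2 := by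
      intro x
      have : latticePoint x = (x.1 : ℝ) • EuclideanSpace.single (0 : Fin 2) (1 : ℝ) +
          (x.2 : ℝ) • EuclideanSpace.single (1 : Fin 2) (1 : ℝ) := by
        ext i
        fin_cases i <;> simp
      rw [this, map_add, map_smul, map_smul, smul_eq_mul, smul_eq_mul]
      ring
    rw [← hexp, ← hexp]
    exact hfv.trans (hfu _ (subset_convexHull ℝ _ ⟨⟨w, hw, rfl⟩,
      fun e => hne (latticePoint_injective e)⟩))
  have hcardS : S.card = 5 ∨ S.card = 6 := by
    have hcard' : P.vertices.ncard = 5 ∨ P.vertices.ncard = 6 := hcard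
    rwa [← hS, Set.ncard_image_of_injective _ latticePoint_injective,
      Set.ncard_coe_finset] at hcard'
  refine ⟨S, hconv, hcardS, ?_⟩
  apply Subtype.ext
  apply Subtype.ext
  exact FullPolytope.ext_carrier hcarrier.symm

/-! ### Connectivity -/

/-- The subgraph induced by the lattice pentagons and the lattice hexagons. -/
abbrev pentagonHexagonGraph : SimpleGraph pentagonsHexagons :=
  (latticePolytopeGraph 2).induce pentagonsHexagons

theorem adj_polygonNode_insert {S : Finset (ℤ × ℤ)} {x : ℤ × ℤ}
    (h : ConvexPosition (S : Set (ℤ × ℤ))) (h' : ConvexPosition ((insert x S : Finset _) : Set _))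
    (hx : x ∉ S) (hcard : S.card = 5 ∨ S.card = 6)
    (hcard' : (insert x S).card = 5 ∨ (insert x S).card = 6) :
    pentagonHexagonGraph.Adj (polygonNode S h hcard) (polygonNode (insert x S) h' hcard') := by
  have hext := h'.extremePoints_latticeHull
  have hx' : latticePoint x ∉ latticePoint '' S := fun ⟨y, hy, e⟩ =>
    hx (latticePoint_injective e ▸ hy)
  have himg : latticePoint '' ((insert x S : Finset _) : Set (ℤ × ℤ)) =
      insert (latticePoint x) (latticePoint '' S) := by
    rw [Finset.coe_insert, Set.image_insert_eq]
  have hhull : latticeHull (insert x S) =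
      convexHull ℝ (latticeHull S ∪ {latticePoint x}) := by
    rw [convexHull_convexHull_union_left, Set.union_singleton, latticeHull, himg]
  -- An extreme point of the larger hull is not in the hull of the other points.
  have hnot : latticePoint x ∉ latticeHull S := by
    have hmem : latticePoint x ∈ (latticeHull (insert x S)).extremePoints ℝ := by
      rw [hext, himg]; exact Set.mem_insert _ _
    rw [(convex_convexHull ℝ _).mem_extremePoints_iff_mem_sdiff_convexHull_sdiff] at hmem
    refine fun hS => hmem.2 (convexHull_mono ?_ hS)
    rintro y hy
    refine ⟨subset_convexHull ℝ _ (himg ▸ Set.mem_insert_of_mem _ hy), ?_⟩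
    rintro rfl
    exact hx' hy
  change (polytopeGraph 2).Adj (latticePolygon S h hcard) (latticePolygon (insert x S) h' hcard')
  rw [polytopeGraph, SimpleGraph.fromRel_adj]
  refine ⟨fun e => ?_, Or.inl (Or.inl ⟨latticePoint x, ⟨hnot, ?_⟩, hhull⟩)⟩
  · have := congrArg FullPolytope.vertices e
    rw [vertices_latticePolygon, vertices_latticePolygon, himg] at this
    exact hx' (this ▸ Set.mem_insert _ _)
  · rw [vertices_latticePolygon]
    change (convexHull ℝ (latticeHull S ∪ {latticePoint x})).extremePoints ℝ = _
    rw [← hhull, hext, himg, Set.union_singleton]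

/-- `S` and `T` are the vertex sets of two lattice polygons in the same connected component. -/
def Linked (S T : Finset (ℤ × ℤ)) : Prop :=
  ∃ hS hS' hT hT', pentagonHexagonGraph.Reachable (polygonNode S hS hS') (polygonNode T hT hT')

theorem Linked.symm {S T : Finset (ℤ × ℤ)} : Linked S T → Linked T S :=
  fun ⟨h₁, h₂, h₃, h₄, h⟩ => ⟨h₃, h₄, h₁, h₂, h.symm⟩

theorem Linked.trans {S T U : Finset (ℤ × ℤ)} : Linked S T → Linked T U → Linked S U :=
  fun ⟨h₁, h₂, _, _, h⟩ ⟨_, _, h₃, h₄, h'⟩ => ⟨h₁, h₂, h₃, h₄, h.trans h'⟩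

theorem linked_insert {S : Finset (ℤ × ℤ)} {x : ℤ × ℤ}
    (h : ConvexPosition ((insert x S : Finset _) : Set (ℤ × ℤ))) (hcard : S.card = 5)
    (hx : x ∉ S) : Linked S (insert x S) :=
  ⟨h.mono (by simp), Or.inl hcard, h, Or.inr (by rw [Finset.card_insert_of_notMem hx, hcard]),
    (adj_polygonNode_insert _ _ hx _ _).reachable⟩

/-- Inserting a point of `T \ S` and then deleting one of `S \ T` passes through a hexagon inside
`W`, so convex position is inherited, and `T \ S` shrinks by one. -/
theorem linked_of_subset {W : Set (ℤ × ℤ)} (hW : ConvexPosition W) {S T : Finset (ℤ × ℤ)}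
    (hS : (S : Set (ℤ × ℤ)) ⊆ W) (hT : (T : Set (ℤ × ℤ)) ⊆ W) (hS5 : S.card = 5)
    (hT5 : T.card = 5) : Linked S T := by
  induction hn : (T \ S).card generalizing S with
  | zero =>
    obtain rfl : T = S := Finset.eq_of_subset_of_card_le
      (Finset.sdiff_eq_empty_iff_subset.1 (Finset.card_eq_zero.1 hn)) (by omega)
    exact ⟨hW.mono hS, Or.inl hS5, hW.mono hS, Or.inl hS5, .rfl⟩
  | succ n ih =>
    obtain ⟨t, ht⟩ : (T \ S).Nonempty := Finset.card_pos.1 (by omega)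
    have hST : (S \ T).card = n + 1 := by
      rw [← hn]; exact Finset.card_sdiff_comm (by omega)
    obtain ⟨s, hs⟩ : (S \ T).Nonempty := Finset.card_pos.1 (by omega)
    rw [Finset.mem_sdiff] at ht hs
    have hst : t ≠ s := fun e => ht.2 (e ▸ hs.1)
    have hsub : ((insert t S : Finset _) : Set (ℤ × ℤ)) ⊆ W := by
      rw [Finset.coe_insert]; exact Set.insert_subset (hT ht.1) hS
    have hins := hW.mono hsub
    set S' := (insert t S).erase s with hS'
    have hS'5 : S'.card = 5 := by
      rw [hS', Finset.card_erase_of_mem (Finset.mem_insert_of_mem hs.1),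
        Finset.card_insert_of_notMem ht.2, hS5]
    have hback : insert s S' = insert t S :=
      Finset.insert_erase (Finset.mem_insert_of_mem hs.1)
    have hdiff : T \ S' = (T \ S).erase t := by
      ext y
      simp only [hS', Finset.mem_sdiff, Finset.mem_erase, Finset.mem_insert]
      have : y ∈ T → y ≠ s := fun hy e => hs.2 (e ▸ hy)
      tauto
    have h1 := linked_insert hins hS5 ht.2
    have h2 : Linked S' (insert s S') :=
      linked_insert (by rwa [hback]) hS'5 (Finset.notMem_erase _ _)
    rw [hback] at h2
    refine (h1.trans h2.symm).trans (ih ?_ hS'5 ?_)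
    · exact (Finset.coe_subset.2 (Finset.erase_subset _ _)).trans hsub
    · rw [hdiff, Finset.card_erase_of_mem (Finset.mem_sdiff.2 ht), hn, Nat.add_sub_cancel]

theorem exists_cross_ne_zero {u : ℤ × ℤ} (hu : u ≠ 0) : ∃ w, cross w u ≠ 0 := by
  refine ⟨(u.2, -u.1), fun h => hu ?_⟩
  simp only [cross] at h
  have h1 : u.1 = 0 := by nlinarith [sq_nonneg u.1, sq_nonneg u.2]
  have h2 : u.2 = 0 := by nlinarith [sq_nonneg u.1, sq_nonneg u.2]
  exact Prod.ext h1 h2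

theorem nonempty_of_card_eq_five {S : Finset (ℤ × ℤ)} (hS : S.card = 5) :
    (S : Set (ℤ × ℤ)).Nonempty :=
  Finset.coe_nonempty.2 (Finset.card_pos.1 (by omega))

/-- Five consecutive points, far out on one parabola of axis `u`, extend both chains and serve as a
common intermediate pentagon. -/
theorem ConvexChain.linked {u : ℤ × ℤ} {S T : Finset (ℤ × ℤ)}
    (hS : ConvexChain u (S : Set (ℤ × ℤ))) (hT : ConvexChain u (T : Set (ℤ × ℤ)))
    (hS5 : S.card = 5) (hT5 : T.card = 5) : Linked S T := by
  obtain ⟨w, hw⟩ := exists_cross_ne_zero (hS.ne_zero (nonempty_of_card_eq_five hS5))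
  obtain ⟨M, hM⟩ := hS.exists_union_parabola hw
  obtain ⟨N, hN⟩ := hT.exists_union_parabola hw
  set K := max M N
  let R : Finset (ℤ × ℤ) := (Finset.Ico K (K + 5)).image (parabola w u)
  have hR5 : R.card = 5 := by
    rw [Finset.card_image_of_injective _ (parabola_injective hw)]; simp
  have hR : ∀ L ≤ K, (R : Set (ℤ × ℤ)) ⊆ parabola w u '' Set.Ici L := by
    intro L hL
    rw [Finset.coe_image]
    exact Set.image_mono fun k hk => hL.trans (Finset.mem_Ico.1 hk).1
  have h1 := linked_of_subset hM.convexPosition Set.subset_union_left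
    ((hR M (le_max_left _ _)).trans Set.subset_union_right) hS5 hR5
  have h2 := linked_of_subset hN.convexPosition Set.subset_union_left
    ((hR N (le_max_right _ _)).trans Set.subset_union_right) hT5 hR5
  exact h1.trans h2.symm

/-- Five points of a parabola. -/
noncomputable def parabolaPentagon (w u : ℤ × ℤ) : Finset (ℤ × ℤ) :=
  (Finset.Ico (-5) 0).image (parabola w u)

theorem card_parabolaPentagon {w u : ℤ × ℤ} (h : cross w u ≠ 0) :
    (parabolaPentagon w u).card = 5 := by
  rw [parabolaPentagon, Finset.card_image_of_injective _ (parabola_injective h)]; simp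

theorem parabolaPentagon_subset (w u : ℤ × ℤ) :
    (parabolaPentagon w u : Set (ℤ × ℤ)) ⊆ parabola w u '' Set.Iio 0 := by
  rw [parabolaPentagon, Finset.coe_image]
  exact Set.image_mono fun k hk => (Finset.mem_Ico.1 hk).2

theorem convexChain_parabolaPentagon_right {w u : ℤ × ℤ} (h : cross w u ≠ 0) :
    ConvexChain u (parabolaPentagon w u : Set (ℤ × ℤ)) :=
  (convexChain_parabola_neg_right h).mono (parabolaPentagon_subset w u)

theorem convexChain_parabolaPentagon_left {w u : ℤ × ℤ} (h : cross w u ≠ 0) :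
    ConvexChain w (parabolaPentagon w u : Set (ℤ × ℤ)) :=
  (convexChain_parabola_neg_left h).mono (parabolaPentagon_subset w u)

/-- The pentagon `parabolaPentagon u' u` is a chain for both directions. -/
theorem ConvexChain.linked_of_cross_ne_zero {u u' : ℤ × ℤ} {S T : Finset (ℤ × ℤ)}
    (hu : cross u' u ≠ 0) (hS : ConvexChain u (S : Set (ℤ × ℤ)))
    (hT : ConvexChain u' (T : Set (ℤ × ℤ))) (hS5 : S.card = 5) (hT5 : T.card = 5) :
    Linked S T :=
  (hS.linked (convexChain_parabolaPentagon_right hu) hS5 (card_parabolaPentagon hu)).trans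
    ((convexChain_parabolaPentagon_left hu).linked hT (card_parabolaPentagon hu) hT5)

theorem ConvexChain.linked_of_convexChain {u u' : ℤ × ℤ} {S T : Finset (ℤ × ℤ)}
    (hS : ConvexChain u (S : Set (ℤ × ℤ))) (hT : ConvexChain u' (T : Set (ℤ × ℤ)))
    (hS5 : S.card = 5) (hT5 : T.card = 5) : Linked S T := by
  by_cases h : cross u' u = 0
  -- Parallel directions may be opposite, so the path goes through a transverse direction `w`.
  · have hu := hS.ne_zero (nonempty_of_card_eq_five hS5)
    have hu' := hT.ne_zero (nonempty_of_card_eq_five hT5)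
    obtain ⟨w, hw⟩ := exists_cross_ne_zero hu
    have hw' : cross w u' ≠ 0 := by
      intro hwu'
      apply hu'
      simp only [cross] at h hw hwu'
      have e1 : u'.1 * (w.1 * u.2 - w.2 * u.1) = 0 := by linear_combination w.1 * h + u.1 * hwu'
      have e2 : u'.2 * (w.1 * u.2 - w.2 * u.1) = 0 := by linear_combination w.2 * h + u.2 * hwu'
      exact Prod.ext ((mul_eq_zero.1 e1).resolve_right hw) ((mul_eq_zero.1 e2).resolve_right hw)
    have hu'w : cross u' w ≠ 0 := by
      intro h0; apply hw'; simp only [cross] at h0 ⊢; linarith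
    have hR := convexChain_parabolaPentagon_left hw
    have hR5 := card_parabolaPentagon hw
    exact (hS.linked_of_cross_ne_zero hw hR hS5 hR5).trans
      (hR.linked_of_cross_ne_zero hu'w hT hR5 hT5)
  · exact hS.linked_of_cross_ne_zero h hT hS5 hT5

theorem exists_convexChain_linked {S : Finset (ℤ × ℤ)} (h : ConvexPosition (S : Set (ℤ × ℤ)))
    (hcard : S.card = 5 ∨ S.card = 6) :
    ∃ T u, Linked S T ∧ T.card = 5 ∧ ConvexChain u (T : Set (ℤ × ℤ)) := by
  have five : ∀ S : Finset (ℤ × ℤ), ConvexPosition (S : Set (ℤ × ℤ)) → S.card = 5 →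
      ∃ T u, Linked S T ∧ T.card = 5 ∧ ConvexChain u (T : Set (ℤ × ℤ)) := by
    intro S h hcard
    obtain ⟨a, b, c, d, e, rfl, hP⟩ := h.exists_pentagon hcard
    obtain ⟨T, u, ⟨W, hW, hSW, hTW⟩, hT5, hT⟩ := hP.nearChain
    exact ⟨T, u, linked_of_subset hW (Finset.coe_subset.2 hSW) (Finset.coe_subset.2 hTW) hcard hT5,
      hT5, hT⟩
  rcases hcard with hcard | hcard
  · exact five S h hcard
  · obtain ⟨x, hx⟩ : S.Nonempty := Finset.card_pos.1 (by omega)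
    have hcard' : (S.erase x).card = 5 := by rw [Finset.card_erase_of_mem hx, hcard]
    have hsub : ((S.erase x : Finset _) : Set (ℤ × ℤ)) ⊆ S :=
      Finset.coe_subset.2 (Finset.erase_subset _ _)
    obtain ⟨T, u, hST, hT5, hT⟩ := five (S.erase x) (h.mono hsub) hcard'
    have hlink : Linked (S.erase x) (insert x (S.erase x)) :=
      linked_insert (by rwa [Finset.insert_erase hx]) hcard' (Finset.notMem_erase _ _)
    rw [Finset.insert_erase hx] at hlink
    exact ⟨T, u, hlink.symm.trans hST, hT5, hT⟩

theorem theorem4 :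
    ((latticePolytopeGraph 2).induce
      {P | P.1.vertices.ncard = 5 ∨ P.1.vertices.ncard = 6}).Connected := by
  change pentagonHexagonGraph.Connected
  have hpre : pentagonHexagonGraph.Preconnected := by
    intro P Q
    obtain ⟨S, hS, hS', rfl⟩ := exists_polygonNode P
    obtain ⟨T, hT, hT', rfl⟩ := exists_polygonNode Q
    obtain ⟨S₁, u, hlinkS, hS5, hu⟩ := exists_convexChain_linked hS hS'
    obtain ⟨T₁, u', hlinkT, hT5, hu'⟩ := exists_convexChain_linked hT hT'
    obtain ⟨_, _, _, _, h⟩ :=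
      (hlinkS.trans (hu.linked_of_convexChain hu' hS5 hT5)).trans hlinkT.symm
    exact h
  have hne : Nonempty pentagonsHexagons := by
    have hw : cross (1, 0) (0, 1) ≠ 0 := by decide
    exact ⟨polygonNode _ (convexChain_parabolaPentagon_right hw).convexPosition
      (Or.inl (card_parabolaPentagon hw))⟩
  exact ⟨hpre⟩
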